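/- Let $r_1,r_2,\varepsilon>0$, and let $\mathfrak B_1=B_{r_1}(\mathbf c_1)$, $\mathfrak B_2=B_{r_2}(\mathbf c_2)$ be the balls in $\mathbb R^3$ with centers $\mathbf c_1=(r_1+\varepsilon,0,0)$ and $\mathbf c_2=(-r_2-\varepsilon,0,0)$. Let $R_i(\mathbf x)=\frac{r_i^2(\mathbf x-\mathbf c_i)}{|\mathbf x-\mathbf c_i|^2}+\mathbf c_i$ be the reflection in $\partial\mathfrak B_i$. For $k\ge 0$ put $$\mathbf p_{1,2k}=(R_1R_2)^k\mathbf c_1,\quad \mathbf p_{1,2k+1}=R_2(R_1R_2)^k\mathbf c_1,\quad \mathbf p_{2,2k}=(R_2R_1)^k\mathbf c_2,\quad \mathbf p_{2,2k+1}=R_1(R_2R_1)^k\mathbf c_2,$$ and let $q_{i,j}=\prod_{l=0}^{j}\mu_{i,l}$ for $i=1,2$ and $j\ge 0$, where $\mu_{i,0}=1$ and, with $i'=3-i$, $$\mu_{i,2k}=\frac{r_i}{|\mathbf c_i-\mathbf p_{i,2k-1}|}\ (k\ge1),\qquad \mu_{i,2k+1}=\frac{r_{i'}}{|\mathbf c_{i'}-\mathbf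 p_{i,2k}|}\ (k\ge0).$$ Set $$Q_i=\sum_{j=0}^\infty(-1)^jq_{i,j}\ (i=1,2),\qquad M=Q_2\sum_{k=0}^\infty q_{1,2k}+Q_1\sum_{k=0}^\infty q_{2,2k+1}.$$ Let $\psi=\psi_0+\gamma$, where $\psi_0=\Gamma'/\Gamma$ is the digamma function and $\gamma$ is the Euler–Mascheroni constant. Then the following hold. 1. For all $r_1,r_2,\varepsilon>0$ the series $\sum_jq_{1,j}$ and $\sum_jq_{2,j}$ converge, and also $M=Q_1\sum_{k=0}^\infty q_{2,2k}+Q_2\sum_{k=0}^\infty q_{1,2k+1}$. 2. For all fixed $r_1,r_2>0$, $$\lim_{\varepsilon\to0^+}Q_1=-\frac{r_2}{r_1+r_2}\,\psi\Big(\frac{r_2}{r_1+r_2}\Big),\qquad \lim_{\varepsilon\to0^+}Q_2=-\frac{r_1}{r_1+r_2}\,\psi\Big(\frac{r_1}{r_1+r_2}\Big).$$ 3. For every $R>0$ there are constants $C>0$ and $\varepsilon_0>0$, depending only on $R$, such that for all $r_1,r_2>0$ with $\max\{r_1,r_2\}=R$ and all $0<\varepsilon<\varepsilon_0$, $$M=-\frac12\,\frac{r_1r_2}{(r_1+r_2)^2}\,|\log\varepsilon|\left(\psi\Big(\frac{r_1}{r_1+r_2}\Big)+\psi\Big(\frac{r_2}{r_1+r_2}\Big)\right)\left(1+\frac{r_1+r_2}{\min\{r_1,r_2\}}\,\theta\right)$$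 for some real $\theta=\theta(r_1,r_2,\varepsilon)$ with $|\theta|\le C|\log\varepsilon|^{-1}$. -/

import Mathlib

open Filter Topology

namespace TwoSpheres

noncomputable section

/-- Three-dimensional Euclidean space. -/
abbrev E3 := EuclideanSpace ℝ (Fin 3)

/-- The center `c₁ = (r₁ + ε, 0, 0)` of the first ball. -/
def center1 (r1 ε : ℝ) : E3 := !₂[r1 + ε, 0, 0]

/-- The center `c₂ = (-r₂ - ε, 0, 0)` of the second ball. -/
def center2 (r2 ε : ℝ) : E3 := !₂[-r2 - ε, 0, 0]

/-- The image points obtained by starting at the center `c` of the sphere of radius `r` and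
reflecting alternately in the other sphere (center `c'`, radius `r'`) and in the sphere itself.
Writing `R`, `R'` for the reflections, it is `(R R')^k c` at `2k` and `R' (R R')^k c` at `2k+1`.
`EuclideanGeometry.inversion c r x = (r / dist x c)² • (x - c) + c`. -/
def imagePoint (c : E3) (r : ℝ) (c' : E3) (r' : ℝ) (j : ℕ) : E3 :=
  if Even j then
    (EuclideanGeometry.inversion c r ∘ EuclideanGeometry.inversion c' r')^[j / 2] c
  else
    EuclideanGeometry.inversion c' r'
      ((EuclideanGeometry.inversion c r ∘ EuclideanGeometry.inversion c' r')^[j / 2] c)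

/-- The factors: `μ₀ = 1`, `μ_{2k+1} = r' / |c' - p_{2k}|`, and
`μ_{2k} = r / |c - p_{2k-1}|` for `k ≥ 1`. -/
def imageFactor (c : E3) (r : ℝ) (c' : E3) (r' : ℝ) : ℕ → ℝ
  | 0 => 1
  | j + 1 =>
    if Even j then r' / dist c' (imagePoint c r c' r' j)
    else r / dist c (imagePoint c r c' r' j)

/-- The image-charge weights `q_j = ∏_{l=0}^{j} μ_l`. -/
def imageWeight (c : E3) (r : ℝ) (c' : E3) (r' : ℝ) (j : ℕ) : ℝ :=
  ∏ l ∈ Finset.range (j + 1), imageFactor c r c' r' l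

/-- The weights `q_{1,j}`, for the chain that starts at `c₁`. -/
def q1 (r1 r2 ε : ℝ) (j : ℕ) : ℝ :=
  imageWeight (center1 r1 ε) r1 (center2 r2 ε) r2 j

/-- The weights `q_{2,j}`, for the chain that starts at `c₂`. -/
def q2 (r1 r2 ε : ℝ) (j : ℕ) : ℝ :=
  imageWeight (center2 r2 ε) r2 (center1 r1 ε) r1 j

/-- `Q₁ = ∑_{j ≥ 0} (-1)^j q_{1,j}`. -/
def Q1 (r1 r2 ε : ℝ) : ℝ := ∑' j : ℕ, (-1 : ℝ) ^ j * q1 r1 r2 ε j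

/-- `Q₂ = ∑_{j ≥ 0} (-1)^j q_{2,j}`. -/
def Q2 (r1 r2 ε : ℝ) : ℝ := ∑' j : ℕ, (-1 : ℝ) ^ j * q2 r1 r2 ε j

/-- `M = Q₂ ∑_k q_{1,2k} + Q₁ ∑_k q_{2,2k+1}`. -/
def M (r1 r2 ε : ℝ) : ℝ :=
  Q2 r1 r2 ε * (∑' k : ℕ, q1 r1 r2 ε (2 * k)) + Q1 r1 r2 ε * (∑' k : ℕ, q2 r1 r2 ε (2 * k + 1))

/-- `ψ = ψ₀ + γ`: the digamma function (logarithmic derivative of the Gamma function) plus the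
Euler-Mascheroni constant. -/
def psi (x : ℝ) : ℝ := logDeriv Real.Gamma x + Real.eulerMascheroniConstant

end

end TwoSpheres

namespace TwoSpheres

noncomputable section

/-! All image points lie on the line of centers, and a composed reflection acts there as a Möbius
map. The weights therefore obey a linear recurrence, whose solution is W_k = U_{k-1}(1+τ), with τ a
multiple of ε to leading order. With a = r₁/(r₁+r₂), b = r₂/(r₁+r₂) and 1+δ the normalized distance
of the centers, the first chain has q_{2k} = b/(b W_{k+1} + a W_k) and q_{2k+1} = b/((1+δ) W_{k+1});
the second chain exchanges a and b (`imageWeight_eq`).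

Pairing consecutive terms turns Q_i into a series of nonnegative terms, dominated by a telescoping
one uniformly in τ (`altSum_tail`). At contact W_k = k, and the pairs become b/(k+b) - b/(k+1),
which sum to -bψ(b) (`altSum_zero`). Comparing partial sums of length about τ^{-1/4} bounds the
difference from contact by a constant times τ^{1/4}, so it stays bounded after multiplication by the
logarithm (`abs_altSum_sub_mul_log_le`).

With S = ∑ 1/W_{k+1}, the odd weights sum to a multiple of S and the even ones to Q_i plus that
multiple, so M = Q₁Q₂ + S(aQ₁ + bQ₂)/(1+δ). This is symmetric in the two balls, which gives the
second formula for M. Since W_k is comparable to k up to k ≈ τ^{-1/2} and grows at least cubically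
beyond, S = log(1+1/τ)/2 + O(1) (`abs_tsum_one_div_chebSeq_sub_le`). Replacing Q_i by its contact
value and log(1+1/τ) by |log ε| costs O(1/(ab)), and the coefficient of the logarithm is bounded
below (`half_le_weighted_altSum`). -/

/-! ### Growth of the Chebyshev sequence. -/

/-- `U_{n-1}(1 + τ)`, with `U` the Chebyshev polynomials of the second kind. -/
def chebSeq (τ : ℝ) : ℕ → ℝ
  | 0 => 0
  | 1 => 1
  | n + 2 => 2 * (1 + τ) * chebSeq τ (n + 1) - chebSeq τ n

@[simp] lemma chebSeq_zero (τ : ℝ) : chebSeq τ 0 = 0 := rfl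

@[simp] lemma chebSeq_one (τ : ℝ) : chebSeq τ 1 = 1 := rfl

lemma chebSeq_add_two (τ : ℝ) (n : ℕ) :
    chebSeq τ (n + 2) = 2 * (1 + τ) * chebSeq τ (n + 1) - chebSeq τ n := rfl

/-- The recurrence says that the increments grow by 2τ W_{k+1}. Inserting W_{k+1} ≥ k+1 and summing
twice produces the cubic term, which later makes the tail of ∑ 1/W_k small. -/
lemma chebSeq_lower {τ : ℝ} (hτ : 0 ≤ τ) (k : ℕ) :
    (k : ℝ) + τ * k * (k ^ 2 - 1) / 3 ≤ chebSeq τ k ∧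
      1 + τ * k * (k + 1) ≤ chebSeq τ (k + 1) - chebSeq τ k := by
  induction k with
  | zero => simp
  | succ k ih =>
    obtain ⟨h1, h2⟩ := ih
    have h3 : (k : ℝ) + 1 + τ * (k + 1) * ((k + 1) ^ 2 - 1) / 3 ≤ chebSeq τ (k + 1) := by
      nlinarith
    have h4 : (k : ℝ) + 1 ≤ chebSeq τ (k + 1) := by
      have : 0 ≤ τ * (k + 1) * (((k : ℝ) + 1) ^ 2 - 1) / 3 := by
        have : (0 : ℝ) ≤ ((k : ℝ) + 1) ^ 2 - 1 := by nlinarith [Nat.cast_nonneg (α := ℝ) k]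
        positivity
      linarith
    push_cast
    refine ⟨h3, ?_⟩
    rw [chebSeq_add_two]
    nlinarith [mul_le_mul_of_nonneg_left h4 hτ]

lemma le_chebSeq {τ : ℝ} (hτ : 0 ≤ τ) (k : ℕ) : (k : ℝ) ≤ chebSeq τ k := by
  induction k with
  | zero => simp
  | succ k ih =>
    have h := (chebSeq_lower hτ k).2
    have : 0 ≤ τ * k * (k + 1) := by positivity
    push_cast
    linarith

lemma chebSeq_nonneg {τ : ℝ} (hτ : 0 ≤ τ) (k : ℕ) : 0 ≤ chebSeq τ k :=
  (Nat.cast_nonneg k).trans (le_chebSeq hτ k)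

lemma chebSeq_succ_pos {τ : ℝ} (hτ : 0 ≤ τ) (k : ℕ) : 0 < chebSeq τ (k + 1) :=
  lt_of_lt_of_le (by positivity) (le_chebSeq hτ (k + 1))

lemma chebSeq_le_succ {τ : ℝ} (hτ : 0 ≤ τ) (k : ℕ) : chebSeq τ k ≤ chebSeq τ (k + 1) := by
  have h := (chebSeq_lower hτ k).2
  have : 0 ≤ τ * k * (k + 1) := by positivity
  linarith

@[simp] lemma chebSeq_zero_left (k : ℕ) : chebSeq 0 k = k := by
  suffices chebSeq 0 k = k ∧ chebSeq 0 (k + 1) = k + 1 from this.1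
  induction k with
  | zero => simp
  | succ k ih =>
    refine ⟨by simpa using ih.2, ?_⟩
    rw [chebSeq_add_two, ih.1, ih.2]
    push_cast
    ring

/-- As long as τn² is at most 1/2, the bound being proved gives W_k ≤ 2k. That crude bound, fed back
into the growth of the increments, closes the induction. -/
lemma chebSeq_upper {τ : ℝ} (hτ : 0 ≤ τ) {n k : ℕ} (hn : 2 * τ * n ^ 2 ≤ 1) (hk : k ≤ n) :
    chebSeq τ k ≤ k * (1 + 2 * τ * n ^ 2) := by
  suffices chebSeq τ k ≤ k * (1 + 2 * τ * n ^ 2) ∧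
      chebSeq τ (k + 1) - chebSeq τ k ≤ 1 + 2 * τ * (k * (k + 1)) from this.1
  induction k with
  | zero => simp
  | succ k ih =>
    obtain ⟨h1, h2⟩ := ih (by omega)
    have hkn : (k : ℝ) + 1 ≤ n := by exact_mod_cast hk
    have hk0 : (0 : ℝ) ≤ k := by positivity
    have h3 : τ * ((k : ℝ) * (k + 1)) ≤ τ * n ^ 2 :=
      mul_le_mul_of_nonneg_left (by nlinarith) hτ
    have h4 : chebSeq τ (k + 1) ≤ (k + 1) * (1 + 2 * τ * n ^ 2) := by linarith
    have h5 : chebSeq τ (k + 1) ≤ (k + 1) * 2 :=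
      h4.trans (mul_le_mul_of_nonneg_left (by linarith) (by positivity))
    push_cast
    refine ⟨h4, ?_⟩
    rw [chebSeq_add_two]
    nlinarith [mul_le_mul_of_nonneg_left h5 hτ]

/-! ### Closed form of the image points and weights. -/

/-- The weight `q_{2k}` of a chain, where `b = r' / (r + r')`. -/
def evenWeight (τ b : ℝ) (k : ℕ) : ℝ := b / (b * chebSeq τ (k + 1) + (1 - b) * chebSeq τ k)

/-- The weight `q_{2k+1}` of a chain, where `b = r' / (r + r')` and `1 + δ` is the distance of
the centers divided by `r + r'`. -/
def oddWeight (τ δ b : ℝ) (k : ℕ) : ℝ := b / ((1 + δ) * chebSeq τ (k + 1))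

lemma inversion_add_smul {c c' : E3} {d : ℝ} (hd : 0 < d) (hcc : dist c c' = d) (r' : ℝ) {x : ℝ}
    (hx : x < 1) :
    dist c' (c + x • (c' - c)) = (1 - x) * d ∧
      EuclideanGeometry.inversion c' r' (c + x • (c' - c)) =
        c' + (r' ^ 2 / ((1 - x) * d ^ 2)) • (c - c') := by
  have h0 : c + x • (c' - c) - c' = (1 - x) • (c - c') := by module
  have h1 : dist (c + x • (c' - c)) c' = (1 - x) * d := by
    rw [dist_eq_norm, h0, norm_smul, Real.norm_of_nonneg (by linarith), ← dist_eq_norm, hcc]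
  refine ⟨by rw [dist_comm, h1], ?_⟩
  rw [EuclideanGeometry.inversion, h1, vsub_eq_sub, h0, vadd_eq_add, smul_smul, add_comm]
  congr 2
  have : 1 - x ≠ 0 := by linarith
  field_simp

lemma imagePoint_odd (c : E3) (r : ℝ) (c' : E3) (r' : ℝ) (k : ℕ) :
    imagePoint c r c' r' (2 * k + 1) =
      EuclideanGeometry.inversion c' r' (imagePoint c r c' r' (2 * k)) := by
  have h1 : (2 * k + 1) / 2 = k := by omega
  have h2 : 2 * k / 2 = k := by omega
  have h3 : ¬ Even (2 * k + 1) := by simp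
  have h4 : Even (2 * k) := by simp
  simp only [imagePoint, if_neg h3, if_pos h4, h1, h2]

lemma imagePoint_even (c : E3) (r : ℝ) (c' : E3) (r' : ℝ) (k : ℕ) :
    imagePoint c r c' r' (2 * k + 2) =
      EuclideanGeometry.inversion c r (imagePoint c r c' r' (2 * k + 1)) := by
  have h1 : (2 * k + 2) / 2 = k + 1 := by omega
  have h2 : (2 * k + 1) / 2 = k := by omega
  have h3 : Even (2 * k + 2) := by simp [Nat.even_add]
  have h4 : ¬ Even (2 * k + 1) := by simp
  simp only [imagePoint, if_neg h4, if_pos h3, h1, h2, Function.iterate_succ', Function.comp_apply]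

lemma imageWeight_odd (c : E3) (r : ℝ) (c' : E3) (r' : ℝ) (k : ℕ) :
    imageWeight c r c' r' (2 * k + 1) =
      imageWeight c r c' r' (2 * k) * (r' / dist c' (imagePoint c r c' r' (2 * k))) := by
  have h4 : Even (2 * k) := by simp
  rw [imageWeight, Finset.prod_range_succ, ← imageWeight, imageFactor, if_pos h4]

lemma imageWeight_even (c : E3) (r : ℝ) (c' : E3) (r' : ℝ) (k : ℕ) :
    imageWeight c r c' r' (2 * k + 2) =
      imageWeight c r c' r' (2 * k + 1) * (r / dist c (imagePoint c r c' r' (2 * k + 1))) := by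
  have h4 : ¬ Even (2 * k + 1) := by simp
  rw [imageWeight, Finset.prod_range_succ, ← imageWeight, imageFactor, if_neg h4]

/-- The image points and weights of a chain in closed form. -/
lemma imageWeight_eq {c c' : E3} {r r' d τ : ℝ} (hr : 0 < r) (hr' : 0 < r') (hτ : 0 ≤ τ)
    (hcc : dist c c' = d) (hd : r + r' < d)
    (hdτ : 2 * (1 + τ) * (r * r') = d ^ 2 - r ^ 2 - r' ^ 2) (k : ℕ) :
    imageWeight c r c' r' (2 * k) = r' / (r' * chebSeq τ (k + 1) + r * chebSeq τ k) ∧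
      imageWeight c r c' r' (2 * k + 1) = r' / (d * chebSeq τ (k + 1)) := by
  have hd0 : 0 < d := by linarith
  have hW := chebSeq_nonneg hτ
  have hW1 := chebSeq_succ_pos hτ
  have hA : ∀ k, 0 < r' * chebSeq τ (k + 1) + r * chebSeq τ k := fun k => by
    have := hW k; have := hW1 k; positivity
  have hmono := chebSeq_le_succ hτ
  have hAd : ∀ k, r * (r' * chebSeq τ (k + 1) + r * chebSeq τ k) <
      d ^ 2 * chebSeq τ (k + 1) := fun k => by
    have h1 : r * (r' * chebSeq τ (k + 1) + r * chebSeq τ k) ≤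
      r * (r' * chebSeq τ (k + 1) + r * chebSeq τ (k + 1)) := by gcongr; exact hmono k
    have h2 : r * (r' + r) < d ^ 2 := by nlinarith
    nlinarith [mul_lt_mul_of_pos_right h2 (hW1 k)]
  -- the step from an even to an odd index
  have stepA : ∀ k, imagePoint c r c' r' (2 * k) = c +
        (r * chebSeq τ k / (r' * chebSeq τ (k + 1) + r * chebSeq τ k)) • (c' - c) →
      imageWeight c r c' r' (2 * k) = r' / (r' * chebSeq τ (k + 1) + r * chebSeq τ k) →
      imagePoint c r c' r' (2 * k + 1) = c' +
        (r' * (r' * chebSeq τ (k + 1) + r * chebSeq τ k) / (d ^ 2 * chebSeq τ (k + 1))) •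
          (c - c') ∧
      imageWeight c r c' r' (2 * k + 1) = r' / (d * chebSeq τ (k + 1)) := by
    intro k hp hw
    have hAk := hA k
    have hWk := hW1 k
    have e : 1 - r * chebSeq τ k / (r' * chebSeq τ (k + 1) + r * chebSeq τ k) =
        r' * chebSeq τ (k + 1) / (r' * chebSeq τ (k + 1) + r * chebSeq τ k) := by
      field_simp; ring
    have hx : r * chebSeq τ k / (r' * chebSeq τ (k + 1) + r * chebSeq τ k) < 1 := by
      rw [div_lt_one hAk]
      have : 0 < r' * chebSeq τ (k + 1) := by positivity
      linarith
    obtain ⟨h1, h2⟩ := inversion_add_smul hd0 hcc r' hx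
    rw [imagePoint_odd, imageWeight_odd, hp, hw, h1, h2, e]
    constructor
    · congr 2
      field_simp
    · field_simp
  have stepB : ∀ k, imagePoint c r c' r' (2 * k + 1) = c' +
        (r' * (r' * chebSeq τ (k + 1) + r * chebSeq τ k) / (d ^ 2 * chebSeq τ (k + 1))) •
          (c - c') →
      imageWeight c r c' r' (2 * k + 1) = r' / (d * chebSeq τ (k + 1)) →
      imagePoint c r c' r' (2 * k + 2) = c +
        (r * chebSeq τ (k + 1) / (r' * chebSeq τ (k + 2) + r * chebSeq τ (k + 1))) • (c' - c) ∧
      imageWeight c r c' r' (2 * k + 2) =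
        r' / (r' * chebSeq τ (k + 2) + r * chebSeq τ (k + 1)) := by
    intro k hp hw
    have hAk := hA k
    have hAk1 := hA (k + 1)
    have hWk := hW1 k
    -- The only use of the relation between τ and d: it makes the reflection back into the first
    -- sphere agree with the three-term recurrence.
    have e0 : r * (r' * chebSeq τ (k + 2) + r * chebSeq τ (k + 1)) =
        d ^ 2 * chebSeq τ (k + 1) - r' * (r' * chebSeq τ (k + 1) + r * chebSeq τ k) := by
      rw [chebSeq_add_two]
      linear_combination chebSeq τ (k + 1) * hdτ
    have e : 1 - r' * (r' * chebSeq τ (k + 1) + r * chebSeq τ k) / (d ^ 2 * chebSeq τ (k + 1)) =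
        r * (r' * chebSeq τ (k + 2) + r * chebSeq τ (k + 1)) / (d ^ 2 * chebSeq τ (k + 1)) := by
      rw [e0]; field_simp
    have hx : r' * (r' * chebSeq τ (k + 1) + r * chebSeq τ k) / (d ^ 2 * chebSeq τ (k + 1)) < 1 := by
      have : 0 < r * (r' * chebSeq τ (k + 2) + r * chebSeq τ (k + 1)) /
        (d ^ 2 * chebSeq τ (k + 1)) := by positivity
      linarith
    obtain ⟨h1, h2⟩ := inversion_add_smul hd0 ((dist_comm _ _).trans hcc) r hx
    rw [imagePoint_even, imageWeight_even, hp, hw, h1, h2, e]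
    constructor
    · congr 2
      field_simp
    · field_simp
  have main : ∀ k, imagePoint c r c' r' (2 * k) = c +
        (r * chebSeq τ k / (r' * chebSeq τ (k + 1) + r * chebSeq τ k)) • (c' - c) ∧
      imageWeight c r c' r' (2 * k) = r' / (r' * chebSeq τ (k + 1) + r * chebSeq τ k) := by
    intro k
    induction k with
    | zero => simp [imagePoint, imageWeight, imageFactor, hr'.ne']
    | succ k ih =>
      obtain ⟨h1, h2⟩ := stepA k ih.1 ih.2
      exact stepB k h1 h2
  exact ⟨(main k).2, (stepA k (main k).1 (main k).2).2⟩

lemma dist_center (r1 r2 : ℝ) {ε : ℝ} (h : 0 ≤ r1 + r2 + 2 * ε) :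
    dist (center1 r1 ε) (center2 r2 ε) = r1 + r2 + 2 * ε := by
  rw [EuclideanSpace.dist_eq]
  simp only [center1, center2, Fin.sum_univ_three]
  simp [Real.dist_eq]
  rw [Real.sqrt_sq (by linarith)]
  ring

/-- The parameter `τ` of the configuration: `1 + τ` is the argument of the Chebyshev polynomials. -/
def gapParam (r1 r2 ε : ℝ) : ℝ := 2 * ε * (r1 + r2 + ε) / (r1 * r2)

lemma gapParam_comm (r1 r2 ε : ℝ) : gapParam r2 r1 ε = gapParam r1 r2 ε := by
  unfold gapParam; rw [add_comm r2, mul_comm r2]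

lemma gapParam_pos {r1 r2 ε : ℝ} (h1 : 0 < r1) (h2 : 0 < r2) (hε : 0 < ε) :
    0 < gapParam r1 r2 ε := by unfold gapParam; positivity

lemma imageWeight_eq_weights {c c' : E3} {r r' ε : ℝ} (hr : 0 < r) (hr' : 0 < r') (hε : 0 < ε)
    (hcc : dist c c' = r + r' + 2 * ε) (k : ℕ) :
    imageWeight c r c' r' (2 * k) = evenWeight (gapParam r r' ε) (r' / (r + r')) k ∧
      imageWeight c r c' r' (2 * k + 1) =
        oddWeight (gapParam r r' ε) (2 * ε / (r + r')) (r' / (r + r')) k := by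
  have hτ := (gapParam_pos hr hr' hε).le
  have hW := chebSeq_nonneg hτ k
  have hW1 := chebSeq_succ_pos hτ k
  obtain ⟨h1, h2⟩ := imageWeight_eq hr hr' hτ hcc (by linarith)
    (by unfold gapParam; field_simp; ring) k
  have e : 1 - r' / (r + r') = r / (r + r') := by field_simp; ring
  constructor
  · rw [h1, evenWeight, e]; field_simp
  · rw [h2, oddWeight]; field_simp

lemma q1_eq {r1 r2 ε : ℝ} (h1 : 0 < r1) (h2 : 0 < r2) (hε : 0 < ε) (k : ℕ) :
    q1 r1 r2 ε (2 * k) = evenWeight (gapParam r1 r2 ε) (r2 / (r1 + r2)) k ∧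
      q1 r1 r2 ε (2 * k + 1) =
        oddWeight (gapParam r1 r2 ε) (2 * ε / (r1 + r2)) (r2 / (r1 + r2)) k :=
  imageWeight_eq_weights h1 h2 hε (dist_center r1 r2 (by positivity)) k

lemma q2_eq {r1 r2 ε : ℝ} (h1 : 0 < r1) (h2 : 0 < r2) (hε : 0 < ε) (k : ℕ) :
    q2 r1 r2 ε (2 * k) = evenWeight (gapParam r1 r2 ε) (r1 / (r1 + r2)) k ∧
      q2 r1 r2 ε (2 * k + 1) =
        oddWeight (gapParam r1 r2 ε) (2 * ε / (r1 + r2)) (r1 / (r1 + r2)) k := by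
  have h := imageWeight_eq_weights (c := center2 r2 ε) (c' := center1 r1 ε) h2 h1 hε
    (by rw [dist_comm, dist_center r1 r2 (by positivity), add_comm r2]) k
  rwa [gapParam_comm, add_comm r2] at h

/-! ### The digamma series. -/

/-- The series `ψ(b) = ∑ (1 / (k + 1) - 1 / (k + b))`. -/
lemma tendsto_psi {b : ℝ} (hb : 0 < b) (hb1 : b ≤ 1) :
    Tendsto (fun n : ℕ => ∑ k ∈ Finset.range n, (1 / ((k : ℝ) + 1) - 1 / (k + b))) atTop
      (𝓝 (psi b)) := by
  let f : ℝ → ℝ := Real.log ∘ Real.Gamma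
  have hc : ConvexOn ℝ (Set.Ioi 0) f := Real.convexOn_log_Gamma
  have h_rec (x : ℝ) (hx : 0 < x) : f (x + 1) = f x + Real.log x := by
    simp only [f, Function.comp_apply, Real.Gamma_add_one hx.ne',
      Real.log_mul hx.ne' (Real.Gamma_pos_of_pos hx).ne', add_comm]
  have hder {x : ℝ} (hx : 0 < x) : DifferentiableAt ℝ f x := by
    refine ((Real.differentiableAt_Gamma ?_).log (Real.Gamma_ne_zero ?_)) <;>
    exact fun m ↦ ne_of_gt (by linarith [Nat.cast_nonneg (α := ℝ) m])
  have hder_rec (x : ℝ) (hx : 0 < x) : deriv f (x + 1) = deriv f x + 1 / x := by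
    rw [← deriv_comp_add_const, one_div, ← Real.deriv_log,
      ← deriv_add (hder <| by positivity) (Real.differentiableAt_log hx.ne')]
    apply EventuallyEq.deriv_eq
    filter_upwards [eventually_gt_nhds hx] using h_rec
  have hlog : logDeriv Real.Gamma b = deriv f b := by
    rw [logDeriv_apply]
    refine (deriv.log (Real.differentiableAt_Gamma fun m => ?_) ?_).symm
    · exact ne_of_gt (by linarith [Nat.cast_nonneg (α := ℝ) m])
    · exact (Real.Gamma_pos_of_pos hb).ne'
  have hder_nat (n : ℕ) :
      deriv f (b + n) = deriv f b + ∑ k ∈ Finset.range n, 1 / ((k : ℝ) + b) := by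
    induction n with
    | zero => simp
    | succ n hn =>
      rw [Finset.sum_range_succ, Nat.cast_succ, ← add_assoc, hder_rec _ (by positivity), hn,
        add_comm b n]
      ring
  -- By convexity of log Γ, its slope on [x, x+1], which is log x, lies between the derivatives at
  -- the endpoints.
  have lower (x : ℝ) (hx : 0 < x) : Real.log x ≤ deriv f (x + 1) := by
    refine (le_of_eq ?_).trans <| hc.slope_le_deriv (Set.mem_Ioi.mpr hx)
      (Set.mem_Ioi.mpr (by positivity : 0 < x + 1)) (by linarith) (hder <| by positivity)
    rw [slope_def_field, show x + 1 - x = (1 : ℝ) by ring, div_one, h_rec x hx, add_sub_cancel_left]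
  have upper (x : ℝ) (hx : 0 < x) : deriv f x ≤ Real.log x := by
    refine (hc.deriv_le_slope (Set.mem_Ioi.mpr hx) (Set.mem_Ioi.mpr (by positivity : 0 < x + 1))
        (by linarith) (hder hx)).trans (le_of_eq ?_)
    rw [slope_def_field, show x + 1 - x = (1 : ℝ) by ring, div_one, h_rec x hx, add_sub_cancel_left]
  have hharm (n : ℕ) : ∑ k ∈ Finset.range n, 1 / ((k : ℝ) + 1) = (harmonic n : ℝ) := by
    simp [harmonic]
  have hsum (n : ℕ) : ∑ k ∈ Finset.range n, (1 / ((k : ℝ) + 1) - 1 / (k + b)) =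
      harmonic n - deriv f (b + n) + deriv f b := by
    rw [Finset.sum_sub_distrib, hharm, hder_nat]; ring
  -- The shift places the derivative at b+n+1, between log n and log(n+2); the second bound uses b ≤
  -- 1.
  rw [← tendsto_add_atTop_iff_nat 1]
  simp only [hsum]
  rw [psi, hlog, add_comm]
  refine Tendsto.add_const _ ?_
  have hlo := (tendsto_add_atTop_iff_nat 1).mpr Real.tendsto_harmonic_sub_log_add_one
  have hhi := Real.tendsto_harmonic_sub_log.add tendsto_one_div_add_atTop_nhds_zero_nat
  rw [add_zero] at hhi
  refine tendsto_of_tendsto_of_tendsto_of_le_of_le' hlo hhi (Eventually.of_forall fun n => ?_) ?_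
  · have h := upper (b + (n + 1 : ℕ)) (by positivity)
    have h' : Real.log (b + (n + 1 : ℕ)) ≤ Real.log ((n + 1 : ℕ) + 1) :=
      Real.log_le_log (by positivity) (by linarith)
    linarith
  · filter_upwards [eventually_gt_atTop 0] with n hn
    have hn' : (0 : ℝ) < n := by exact_mod_cast hn
    have h := lower (b + n) (by positivity)
    have h' : Real.log n ≤ Real.log (b + n) := Real.log_le_log hn' (by linarith)
    have e : b + ((n + 1 : ℕ) : ℝ) = b + n + 1 := by push_cast; ring
    rw [e, harmonic_succ]
    push_cast
    rw [one_div]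
    linarith

lemma one_div_chebSeq_le {τ : ℝ} (hτ : 0 ≤ τ) (k : ℕ) :
    1 / chebSeq τ (k + 1) ≤ 1 / ((k : ℝ) + 1) := by
  have h := le_chebSeq hτ (k + 1)
  push_cast at h
  exact one_div_le_one_div_of_le (by positivity) h

/-! ### The alternating sums and their limit at contact. -/

section Weights

variable {τ δ b : ℝ}

lemma evenWeight_nonneg (hτ : 0 ≤ τ) (hb : 0 < b) (hb1 : b < 1) (k : ℕ) :
    0 ≤ evenWeight τ b k := by
  have := chebSeq_nonneg hτ k
  have := chebSeq_nonneg hτ (k + 1)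
  have : 0 < 1 - b := by linarith
  unfold evenWeight
  positivity

lemma oddWeight_nonneg (hτ : 0 ≤ τ) (hδ : 0 ≤ δ) (hb : 0 < b) (k : ℕ) :
    0 ≤ oddWeight τ δ b k := by
  have := chebSeq_nonneg hτ (k + 1)
  unfold oddWeight
  positivity

lemma evenWeight_le (hτ : 0 ≤ τ) (hb : 0 < b) (hb1 : b < 1) (k : ℕ) :
    evenWeight τ b k ≤ 1 / chebSeq τ (k + 1) := by
  have h0 := chebSeq_nonneg hτ k
  have h1 := chebSeq_succ_pos hτ k
  have : 0 < 1 - b := by linarith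
  unfold evenWeight
  rw [div_le_div_iff₀ (by positivity) h1]
  nlinarith [mul_nonneg this.le h0]

lemma oddWeight_le_evenWeight (hτ : 0 ≤ τ) (hδ : 0 ≤ δ) (hb : 0 < b) (hb1 : b < 1) (k : ℕ) :
    oddWeight τ δ b k ≤ evenWeight τ b k := by
  have h0 := chebSeq_nonneg hτ k
  have h1 := chebSeq_succ_pos hτ k
  have hm := chebSeq_le_succ hτ k
  have : 0 < 1 - b := by linarith
  unfold evenWeight oddWeight
  apply div_le_div_of_nonneg_left hb.le (by positivity)
  nlinarith [mul_le_mul_of_nonneg_left hm this.le, mul_nonneg hδ h1.le]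

/-- By the recurrence, the denominator on the left is W_{k+1}(1+2bτ) + b(W_{k+1} - W_k). Hence the
condition δ ≤ 2bτ suffices. -/
lemma evenWeight_succ_le_oddWeight (hτ : 0 ≤ τ) (hδ : 0 ≤ δ) (hδb : δ ≤ 2 * b * τ) (hb : 0 < b)
    (k : ℕ) : evenWeight τ b (k + 1) ≤ oddWeight τ δ b k := by
  have h1 := chebSeq_succ_pos hτ k
  have hm := chebSeq_le_succ hτ k
  unfold evenWeight oddWeight
  apply div_le_div_of_nonneg_left hb.le (by positivity)
  rw [chebSeq_add_two]
  nlinarith [mul_le_mul_of_nonneg_right hδb h1.le]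

/-- The terms `q_{2k} - q_{2k+1}` of the paired alternating series. -/
def pairWeight (τ δ b : ℝ) (k : ℕ) : ℝ := evenWeight τ b k - oddWeight τ δ b k

lemma pairWeight_nonneg (hτ : 0 ≤ τ) (hδ : 0 ≤ δ) (hb : 0 < b) (hb1 : b < 1) (k : ℕ) :
    0 ≤ pairWeight τ δ b k :=
  sub_nonneg.mpr (oddWeight_le_evenWeight hτ hδ hb hb1 k)

/-- Since q_{2k+1} ≥ q_{2k+2}, each pair is at most q_{2k} - q_{2k+2}, which telescopes. -/
lemma sum_pairWeight_add_le (hτ : 0 ≤ τ) (hδ : 0 ≤ δ) (hδb : δ ≤ 2 * b * τ) (hb : 0 < b) (n m : ℕ) :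
    ∑ k ∈ Finset.range m, pairWeight τ δ b (k + n) ≤
      evenWeight τ b n - evenWeight τ b (m + n) := by
  induction m with
  | zero => simp
  | succ m ih =>
    rw [Finset.sum_range_succ, show m + 1 + n = m + n + 1 by ring]
    have := evenWeight_succ_le_oddWeight hτ hδ hδb hb (m + n)
    unfold pairWeight at ih ⊢
    linarith

lemma summable_pairWeight (hτ : 0 ≤ τ) (hδ : 0 ≤ δ) (hδb : δ ≤ 2 * b * τ) (hb : 0 < b)
    (hb1 : b < 1) : Summable (pairWeight τ δ b) :=
  summable_of_sum_range_le (c := evenWeight τ b 0) (pairWeight_nonneg hτ hδ hb hb1) fun m => by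
    have h := sum_pairWeight_add_le hτ hδ hδb hb 0 m
    have := evenWeight_nonneg hτ hb hb1 (m + 0)
    simp only [add_zero] at h this
    linarith

/-- The alternating sum of the weights of a chain. -/
def altSum (τ δ b : ℝ) : ℝ := ∑' k, pairWeight τ δ b k

lemma altSum_tail (hτ : 0 ≤ τ) (hδ : 0 ≤ δ) (hδb : δ ≤ 2 * b * τ) (hb : 0 < b)
    (hb1 : b < 1) (n : ℕ) :
    ∑ k ∈ Finset.range n, pairWeight τ δ b k ≤ altSum τ δ b ∧
      altSum τ δ b ≤ ∑ k ∈ Finset.range n, pairWeight τ δ b k + 1 / ((n : ℝ) + 1) := by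
  have hs := summable_pairWeight hτ hδ hδb hb hb1
  have hp := pairWeight_nonneg hτ hδ hb hb1
  refine ⟨hs.sum_le_tsum _ fun k _ => hp k, ?_⟩
  rw [altSum, ← hs.sum_add_tsum_nat_add n]
  gcongr
  refine (Real.tsum_le_of_sum_range_le (fun k => hp _) fun m => ?_).trans
    ((evenWeight_le hτ hb hb1 n).trans (one_div_chebSeq_le hτ n))
  have := evenWeight_nonneg hτ hb hb1 (m + n)
  linarith [sum_pairWeight_add_le hτ hδ hδb hb n m]

lemma altSum_nonneg (hτ : 0 ≤ τ) (hδ : 0 ≤ δ) (hb : 0 < b) (hb1 : b < 1) : 0 ≤ altSum τ δ b :=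
  tsum_nonneg (pairWeight_nonneg hτ hδ hb hb1)

lemma altSum_le_one (hτ : 0 ≤ τ) (hδ : 0 ≤ δ) (hδb : δ ≤ 2 * b * τ) (hb : 0 < b) (hb1 : b < 1) :
    altSum τ δ b ≤ 1 := by
  simpa using (altSum_tail hτ hδ hδb hb hb1 0).2

lemma one_sub_le_altSum_zero (hb : 0 < b) (hb1 : b < 1) : 1 - b ≤ altSum 0 0 b := by
  have h := (altSum_tail le_rfl le_rfl (by simp) hb hb1 1).1
  simpa [pairWeight, evenWeight, oddWeight, hb.ne'] using h

lemma altSum_zero (hb : 0 < b) (hb1 : b < 1) : altSum 0 0 b = -b * psi b := by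
  have h1 := (summable_pairWeight (τ := 0) (δ := 0) le_rfl le_rfl (by simp)
    hb hb1).hasSum.tendsto_sum_nat
  have h2 := (tendsto_psi hb hb1.le).const_mul (-b)
  refine tendsto_nhds_unique h1 (h2.congr fun n => ?_)
  rw [Finset.mul_sum]
  refine Finset.sum_congr rfl fun k _ => ?_
  have e : b * ((k : ℝ) + 1) + (1 - b) * k = k + b := by ring
  simp only [pairWeight, evenWeight, oddWeight, chebSeq_zero_left, Nat.cast_succ, e, add_zero,
    one_mul]
  ring

/-- Because b ≤ Y, a relative error η in the denominator costs at most η in absolute terms,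
uniformly in b. -/
lemma div_sub_div_mem {b X Y η : ℝ} (hb : 0 < b) (hbX : b ≤ X) (hXY : X ≤ Y)
    (hY : Y ≤ X * (1 + η)) : 0 ≤ b / X - b / Y ∧ b / X - b / Y ≤ η := by
  have hX : 0 < X := by linarith
  have hY0 : 0 < Y := by linarith
  refine ⟨sub_nonneg.mpr (div_le_div_of_nonneg_left hb.le hX hXY), ?_⟩
  have e : b / X - b / Y = b * (Y - X) / (X * Y) := by field_simp
  rw [e, div_le_iff₀ (by positivity)]
  have h1 : b * (Y - X) ≤ Y * (X * η) :=
    mul_le_mul (by linarith) (by linarith) (by linarith) hY0.le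
  linarith

lemma abs_pairWeight_sub_le (hτ : 0 ≤ τ) (hδ : 0 ≤ δ) (hδτ : δ ≤ τ) (hb : 0 < b)
    (hb1 : b < 1) {n k : ℕ} (hn : 2 * τ * n ^ 2 ≤ 1) (hk : k < n) :
    |pairWeight τ δ b k - pairWeight 0 0 b k| ≤ 4 * τ * n ^ 2 := by
  set η := 2 * τ * n ^ 2 with hη
  have hη0 : 0 ≤ η := by positivity
  have hn1 : (1 : ℝ) ≤ n := by exact_mod_cast (by omega : 1 ≤ n)
  have hδη : 2 * δ ≤ η := by
    have : τ * 1 ≤ τ * n ^ 2 := mul_le_mul_of_nonneg_left (by nlinarith) hτ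
    linarith
  have l0 := le_chebSeq hτ k
  have l1 := le_chebSeq hτ (k + 1)
  have u0 := chebSeq_upper hτ hn hk.le
  have u1 := chebSeq_upper hτ hn (Nat.succ_le_of_lt hk)
  push_cast at l1 u1
  rw [← hη] at u0 u1
  have hk0 : (0 : ℝ) ≤ k := by positivity
  have hb' : 0 ≤ 1 - b := by linarith
  have he := div_sub_div_mem (X := (k : ℝ) + b)
    (Y := b * chebSeq τ (k + 1) + (1 - b) * chebSeq τ k) hb (by linarith)
    (by nlinarith [mul_le_mul_of_nonneg_left l0 hb', mul_le_mul_of_nonneg_left l1 hb.le])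
    (by nlinarith [mul_le_mul_of_nonneg_left u0 hb', mul_le_mul_of_nonneg_left u1 hb.le])
  have ho := div_sub_div_mem (X := (k : ℝ) + 1) (Y := (1 + δ) * chebSeq τ (k + 1))
    (η := 2 * η) hb (by linarith)
    (by nlinarith [mul_nonneg hδ (chebSeq_nonneg hτ (k + 1))])
    (by
      have h1 : (1 + δ) * chebSeq τ (k + 1) ≤ (1 + δ) * (((k : ℝ) + 1) * (1 + η)) := by gcongr
      have h2 : (1 + δ) * (1 + η) ≤ 1 + 2 * η := by nlinarith
      nlinarith [mul_le_mul_of_nonneg_left h2 (by positivity : (0 : ℝ) ≤ (k : ℝ) + 1)])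
  have e : b * ((k : ℝ) + 1) + (1 - b) * k = k + b := by ring
  simp only [pairWeight, evenWeight, oddWeight, chebSeq_zero_left, Nat.cast_succ, e, add_zero,
    one_mul]
  rw [abs_le]
  constructor <;> linarith [he.1, he.2, ho.1, ho.2]

/-- Both tails lie in [0, 1/(n+1)], and the n leading pairs differ by at most 4τn² each. The cutoff
n is left free for optimization. -/
lemma abs_altSum_sub_le (hτ : 0 ≤ τ) (hδ : 0 ≤ δ) (hδτ : δ ≤ τ) (hδb : δ ≤ 2 * b * τ) (hb : 0 < b)
    (hb1 : b < 1) {n : ℕ} (hn : 2 * τ * n ^ 2 ≤ 1) :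
    |altSum τ δ b - altSum 0 0 b| ≤ 1 / ((n : ℝ) + 1) + 4 * τ * n ^ 3 := by
  obtain ⟨h1, h2⟩ := altSum_tail hτ hδ hδb hb hb1 n
  obtain ⟨h3, h4⟩ := altSum_tail (τ := 0) (δ := 0) le_rfl le_rfl (by simp) hb hb1 n
  have h5 : |∑ k ∈ Finset.range n, pairWeight τ δ b k -
      ∑ k ∈ Finset.range n, pairWeight 0 0 b k| ≤ 4 * τ * n ^ 3 := by
    rw [← Finset.sum_sub_distrib]
    refine (Finset.abs_sum_le_sum_abs _ _).trans ((Finset.sum_le_card_nsmul _ _ (4 * τ * n ^ 2)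
      fun k hk => abs_pairWeight_sub_le hτ hδ hδτ hb hb1 hn (Finset.mem_range.mp hk)).trans ?_)
    rw [Finset.card_range, nsmul_eq_mul]
    apply le_of_eq; ring
  rw [abs_le] at h5 ⊢
  constructor <;> linarith [h5.1, h5.2]

/-- The alternating sum converges to its value at contact faster than any logarithm. -/
lemma abs_altSum_sub_mul_log_le (hτ : 0 < τ) (hδ : 0 ≤ δ) (hδτ : δ ≤ τ) (hδb : δ ≤ 2 * b * τ)
    (hb : 0 < b) (hb1 : b < 1) :
    |altSum τ δ b - altSum 0 0 b| * Real.log (1 + 1 / τ) ≤ 20 := by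
  -- Balancing 1/n against τn³ suggests n ≈ y = τ^{-1/4}. The difference is then at most 5/y and the
  -- logarithm at most 4y.
  obtain ⟨y, hy0, hy⟩ : ∃ y : ℝ, 0 < y ∧ τ = 1 / y ^ 4 := by
    refine ⟨√√(1 / τ), by positivity, ?_⟩
    rw [show √√(1 / τ) ^ 4 = (√√(1 / τ) ^ 2) ^ 2 by ring, Real.sq_sqrt (by positivity),
      Real.sq_sqrt (by positivity)]
    simp
  have hlog0 : 0 ≤ Real.log (1 + 1 / τ) := Real.log_nonneg (by
    have : 0 < 1 / τ := by positivity
    linarith)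
  have hinv : 1 / τ = y ^ 4 := by rw [hy]; simp
  -- For y < 2 the cutoff condition 2τn² ≤ 1 is not guaranteed, but the logarithm is at most y⁴ ≤ 16
  -- and the difference at most 1.
  rcases lt_or_ge y 2 with h | h
  · have hQ : |altSum τ δ b - altSum 0 0 b| ≤ 1 := by
      have h1 := altSum_nonneg hτ.le hδ hb hb1
      have h2 := altSum_le_one hτ.le hδ hδb hb hb1
      have h3 := altSum_nonneg (τ := 0) (δ := 0) le_rfl le_rfl hb hb1
      have h4 := altSum_le_one (τ := 0) (δ := 0) le_rfl le_rfl (by simp) hb hb1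
      rw [abs_le]; constructor <;> linarith
    have hl : Real.log (1 + 1 / τ) ≤ 20 := by
      have h1 := Real.log_le_sub_one_of_pos (by positivity : 0 < 1 + 1 / τ)
      have h2 : y ^ 4 ≤ 2 ^ 4 := by gcongr
      rw [hinv] at h1 ⊢
      linarith
    calc _ ≤ 1 * (20 : ℝ) := mul_le_mul hQ hl hlog0 zero_le_one
      _ = 20 := by norm_num
  · have hfl := Nat.floor_le hy0.le
    have hlt := Nat.lt_floor_add_one y
    have hn : 2 * τ * (⌊y⌋₊ : ℝ) ^ 2 ≤ 1 := by
      calc 2 * τ * (⌊y⌋₊ : ℝ) ^ 2 ≤ 2 * τ * y ^ 2 := by gcongr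
        _ = 2 / y ^ 2 := by rw [hy]; field_simp
        _ ≤ 1 := by rw [div_le_one (by positivity)]; nlinarith
    have hQ : |altSum τ δ b - altSum 0 0 b| ≤ 5 / y := by
      calc _ ≤ 1 / ((⌊y⌋₊ : ℝ) + 1) + 4 * τ * (⌊y⌋₊ : ℝ) ^ 3 :=
            abs_altSum_sub_le hτ.le hδ hδτ hδb hb hb1 hn
        _ ≤ 1 / y + 4 * τ * y ^ 3 := by gcongr
        _ = 5 / y := by rw [hy]; field_simp; norm_num
    have hl : Real.log (1 + 1 / τ) ≤ 4 * y := by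
      have h1 : Real.log (1 + 1 / τ) ≤ Real.log (2 * y ^ 4) := by
        apply Real.log_le_log (by positivity)
        rw [hinv]
        have : 1 ≤ y ^ 4 := one_le_pow₀ (by linarith)
        linarith
      rw [Real.log_mul (by norm_num) (by positivity), Real.log_pow] at h1
      have h2 := Real.log_le_sub_one_of_pos hy0
      have h3 := Real.log_le_sub_one_of_pos (by norm_num : (0 : ℝ) < 2)
      push_cast at h1
      linarith
    calc _ ≤ 5 / y * (4 * y) := mul_le_mul hQ hl hlog0 (by positivity)
      _ = 20 := by field_simp; norm_num

end Weights

/-! ### Logarithmic growth of the sum of reciprocals. -/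

lemma sum_one_div_chebSeq_le {τ : ℝ} (hτ : 0 < τ) (m : ℕ) :
    ∑ k ∈ Finset.range m, 1 / chebSeq τ (k + 1) ≤ Real.log (1 + 1 / τ) / 2 + 3 := by
  obtain ⟨x, hx0, hx⟩ : ∃ x : ℝ, 0 < x ∧ 1 / τ = x ^ 2 :=
    ⟨√(1 / τ), by positivity, (Real.sq_sqrt (by positivity)).symm⟩
  have hτx : τ = 1 / x ^ 2 := by rw [← hx]; simp
  set N := ⌊x⌋₊ + 1 with hN
  have hxN : x ≤ N := by rw [hN]; push_cast; exact (Nat.lt_floor_add_one x).le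
  have hNx : (N : ℝ) ≤ 1 + x := by
    rw [hN]; push_cast; linarith [Nat.floor_le hx0.le]
  have hN0 : (0 : ℝ) < N := lt_of_lt_of_le hx0 hxN
  have hpos : ∀ k, 0 ≤ 1 / chebSeq τ (k + 1) := fun k =>
    one_div_nonneg.mpr (chebSeq_nonneg hτ.le _)
  -- Up to N ≈ τ^{-1/2} the terms are compared with the harmonic sum. Beyond it the cubic lower
  -- bound gives terms 3/(τ j(j+1)(j+2)), which telescope to a total of at most 3/2.
  have key : ∀ m : ℕ, ∑ k ∈ Finset.range (N + m), 1 / chebSeq τ (k + 1) ≤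
      harmonic N + 3 / (2 * τ) * (1 / ((N : ℝ) * (N + 1)) -
        1 / (((N : ℝ) + m) * (N + m + 1))) := by
    intro m
    induction m with
    | zero =>
      simp only [add_zero, Nat.cast_zero, sub_self, mul_zero, harmonic]
      push_cast
      exact Finset.sum_le_sum fun k _ => by
        simpa using one_div_chebSeq_le hτ.le k
    | succ m ih =>
      rw [← add_assoc, Finset.sum_range_succ]
      have h1 := (chebSeq_lower hτ.le (N + m + 1)).1
      push_cast at h1 ⊢
      set j : ℝ := (N : ℝ) + m with hj
      have hj0 : 0 < j := by positivity
      have h2 : τ * (j * (j + 1) * (j + 2)) / 3 ≤ chebSeq τ (N + m + 1) := by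
        have e : τ * (j + 1) * ((j + 1) ^ 2 - 1) / 3 = τ * (j * (j + 1) * (j + 2)) / 3 := by ring
        linarith
      have h3 : 1 / chebSeq τ (N + m + 1) ≤ 1 / (τ * (j * (j + 1) * (j + 2)) / 3) :=
        one_div_le_one_div_of_le (by positivity) h2
      have h4 : 1 / (τ * (j * (j + 1) * (j + 2)) / 3) =
          3 / (2 * τ) * (1 / (j * (j + 1)) - 1 / ((j + 1) * (j + 1 + 1))) := by
        field_simp; ring
      have e : (N : ℝ) + (m + 1) = j + 1 := by rw [hj]; ring
      rw [e]
      rw [h4] at h3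
      nlinarith
  have hmono : ∑ k ∈ Finset.range m, 1 / chebSeq τ (k + 1) ≤
      ∑ k ∈ Finset.range (N + m), 1 / chebSeq τ (k + 1) :=
    Finset.sum_le_sum_of_subset_of_nonneg (Finset.range_mono (by omega)) fun k _ _ => hpos k
  have htail : 3 / (2 * τ) * (1 / ((N : ℝ) * (N + 1)) -
        1 / (((N : ℝ) + m) * (N + m + 1))) ≤ 3 / 2 := by
    have h1 : (0 : ℝ) ≤ 1 / (((N : ℝ) + m) * (N + m + 1)) := by positivity
    have h2 : 1 / ((N : ℝ) * (N + 1)) ≤ 1 / (x * x) := by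
      apply one_div_le_one_div_of_le (by positivity)
      apply mul_le_mul hxN (by linarith) hx0.le hN0.le
    have h3 : 3 / (2 * τ) * (1 / (x * x)) = 3 / 2 := by rw [hτx]; field_simp
    rw [← h3]
    gcongr
    linarith
  have hharm := harmonic_le_one_add_log N
  have hlog : Real.log N ≤ Real.log (1 + 1 / τ) / 2 + 1 / 2 := by
    have h1 : Real.log ((N : ℝ) ^ 2) ≤ Real.log (2 * (1 + 1 / τ)) := by
      apply Real.log_le_log (by positivity)
      rw [hx]
      nlinarith [sq_nonneg (x - 1)]
    rw [Real.log_pow, Real.log_mul (by norm_num) (by positivity)] at h1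
    have h2 := Real.log_le_sub_one_of_pos (by norm_num : (0 : ℝ) < 2)
    push_cast at h1
    linarith
  linarith [key m]

lemma summable_one_div_chebSeq {τ : ℝ} (hτ : 0 < τ) :
    Summable fun k => 1 / chebSeq τ (k + 1) :=
  summable_of_sum_range_le (fun _ => one_div_nonneg.mpr (chebSeq_nonneg hτ.le _))
    (sum_one_div_chebSeq_le hτ)

/-- Only the first n ≈ τ^{-1/2}/2 terms are kept. Each differs from 1/(k+1) by at most 2τn, so the
total loss 2τn² is bounded. -/
lemma le_tsum_one_div_chebSeq {τ : ℝ} (hτ : 0 < τ) :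
    Real.log (1 + 1 / τ) / 2 - 3 ≤ ∑' k, 1 / chebSeq τ (k + 1) := by
  obtain ⟨x, hx0, hx⟩ : ∃ x : ℝ, 0 < x ∧ 1 / τ = x ^ 2 :=
    ⟨√(1 / τ), by positivity, (Real.sq_sqrt (by positivity)).symm⟩
  have hτx : τ = 1 / x ^ 2 := by rw [← hx]; simp
  set n := ⌊x / 2⌋₊ with hn
  have hnx : (n : ℝ) ≤ x / 2 := Nat.floor_le (by positivity)
  have hxn : x / 2 < n + 1 := Nat.lt_floor_add_one _
  have hn0 : (0 : ℝ) ≤ n := by positivity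
  have hτn : 2 * τ * (n : ℝ) ^ 2 ≤ 1 := by
    calc 2 * τ * (n : ℝ) ^ 2 ≤ 2 * τ * (x / 2) ^ 2 := by gcongr
      _ = 1 / 2 := by rw [hτx]; field_simp
      _ ≤ 1 := by norm_num
  have hterm : ∀ k ∈ Finset.range n, 1 / ((k : ℝ) + 1) - 2 * τ * n ≤ 1 / chebSeq τ (k + 1) := by
    intro k hk
    have hkn : (k : ℝ) + 1 ≤ n := by exact_mod_cast Finset.mem_range.mp hk
    have hk0 : (0 : ℝ) < (k : ℝ) + 1 := by positivity
    have hsq : 2 * τ * ((k : ℝ) + 1) ^ 2 ≤ 2 * τ * (n : ℝ) ^ 2 := by gcongr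
    have hu := chebSeq_upper hτ.le (n := k + 1) (k := k + 1)
      (by push_cast; exact hsq.trans hτn) le_rfl
    push_cast at hu
    have h1 : 1 / (((k : ℝ) + 1) * (1 + 2 * τ * ((k : ℝ) + 1) ^ 2)) ≤ 1 / chebSeq τ (k + 1) :=
      one_div_le_one_div_of_le (chebSeq_succ_pos hτ.le k) hu
    refine le_trans ?_ h1
    have h2 : 1 / ((k : ℝ) + 1) - 2 * τ * (k + 1) ≤
        1 / (((k : ℝ) + 1) * (1 + 2 * τ * ((k : ℝ) + 1) ^ 2)) := by
      rw [le_div_iff₀ (by positivity)]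
      have e : (1 / ((k : ℝ) + 1) - 2 * τ * (k + 1)) *
        (((k : ℝ) + 1) * (1 + 2 * τ * ((k : ℝ) + 1) ^ 2)) =
          1 - (2 * τ * ((k : ℝ) + 1) ^ 2) ^ 2 := by field_simp; ring
      rw [e]
      nlinarith [sq_nonneg (2 * τ * ((k : ℝ) + 1) ^ 2)]
    have h3 : 2 * τ * ((k : ℝ) + 1) ≤ 2 * τ * n := by gcongr
    linarith
  have hsum := Finset.sum_le_sum hterm
  rw [Finset.sum_sub_distrib, Finset.sum_const, Finset.card_range, nsmul_eq_mul] at hsum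
  have hharm : ∑ k ∈ Finset.range n, 1 / ((k : ℝ) + 1) = (harmonic n : ℝ) := by simp [harmonic]
  rw [hharm] at hsum
  have hle := (summable_one_div_chebSeq hτ).sum_le_tsum (Finset.range n)
    fun k _ => one_div_nonneg.mpr (chebSeq_nonneg hτ.le _)
  have hH := log_add_one_le_harmonic n
  push_cast at hH
  have hlog : Real.log (1 + 1 / τ) ≤ 4 + 2 * Real.log ((n : ℝ) + 1) := by
    have h1 : Real.log (1 + 1 / τ) ≤ Real.log (5 * ((n : ℝ) + 1) ^ 2) := by
      apply Real.log_le_log (by positivity)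
      rw [hx]
      nlinarith
    rw [Real.log_mul (by norm_num) (by positivity), Real.log_pow] at h1
    have h2 := Real.log_le_sub_one_of_pos (by norm_num : (0 : ℝ) < 5)
    push_cast at h1
    linarith
  nlinarith

lemma abs_tsum_one_div_chebSeq_sub_le {τ : ℝ} (hτ : 0 < τ) :
    |(∑' k, 1 / chebSeq τ (k + 1)) - Real.log (1 + 1 / τ) / 2| ≤ 3 := by
  have h1 := le_tsum_one_div_chebSeq hτ
  have h2 := Real.tsum_le_of_sum_range_le
    (fun k => one_div_nonneg.mpr (chebSeq_nonneg hτ.le (k + 1))) (sum_one_div_chebSeq_le hτ)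
  rw [abs_le]
  constructor <;> linarith

/-- The sums over a chain whose even and odd weights are known. -/
lemma sums_of_weights {τ δ b : ℝ} {q : ℕ → ℝ} (hτ : 0 < τ) (hδ : 0 ≤ δ) (hb : 0 < b)
    (hb1 : b < 1)
    (hq : ∀ k, q (2 * k) = evenWeight τ b k ∧ q (2 * k + 1) = oddWeight τ δ b k) :
    Summable q ∧ ∑' j, (-1 : ℝ) ^ j * q j = altSum τ δ b ∧
      ∑' k, q (2 * k) = altSum τ δ b + b / (1 + δ) * ∑' k, 1 / chebSeq τ (k + 1) ∧
      ∑' k, q (2 * k + 1) = b / (1 + δ) * ∑' k, 1 / chebSeq τ (k + 1) := by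
  have hS := summable_one_div_chebSeq hτ
  have he : Summable (evenWeight τ b) :=
    hS.of_nonneg_of_le (evenWeight_nonneg hτ.le hb hb1) (evenWeight_le hτ.le hb hb1)
  have ho : Summable (oddWeight τ δ b) :=
    he.of_nonneg_of_le (oddWeight_nonneg hτ.le hδ hb) (oddWeight_le_evenWeight hτ.le hδ hb hb1)
  have hodd : ∑' k, oddWeight τ δ b k = b / (1 + δ) * ∑' k, 1 / chebSeq τ (k + 1) := by
    rw [← tsum_mul_left]
    refine tsum_congr fun k => ?_
    rw [oddWeight, div_mul_div_comm, mul_one]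
  have hsub : altSum τ δ b = ∑' k, evenWeight τ b k - ∑' k, oddWeight τ δ b k :=
    he.tsum_sub ho
  have hqe : (fun k => q (2 * k)) = evenWeight τ b := funext fun k => (hq k).1
  have hqo : (fun k => q (2 * k + 1)) = oddWeight τ δ b := funext fun k => (hq k).2
  refine ⟨?_, ?_, ?_, ?_⟩
  · exact (HasSum.even_add_odd (f := q) (hqe ▸ he.hasSum) (hqo ▸ ho.hasSum)).summable
  · rw [hsub, sub_eq_add_neg]
    refine (HasSum.even_add_odd (f := fun j => (-1 : ℝ) ^ j * q j) ?_ ?_).tsum_eq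
    · simpa [hq] using he.hasSum
    · simpa [hq, pow_succ] using ho.hasSum.neg
  · rw [hqe, hsub, ← hodd]; ring
  · rw [hqo, hodd]

/-! ### Asymptotics in terms of the normalized gap. -/

lemma gapParam_eq {r1 r2 : ℝ} (h1 : 0 < r1) (h2 : 0 < r2) (ε : ℝ) :
    gapParam r1 r2 ε = (2 * ε / (r1 + r2) + (2 * ε / (r1 + r2)) ^ 2 / 2) /
      (r1 / (r1 + r2) * (r2 / (r1 + r2))) := by
  unfold gapParam
  field_simp

lemma le_gap {τ δ a b : ℝ} (ha : 0 < a) (hb : 0 < b) (hab : a + b = 1) (hδ : 0 < δ)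
    (hτ : τ = (δ + δ ^ 2 / 2) / (a * b)) : δ ≤ τ ∧ δ ≤ a * τ ∧ δ ≤ b * τ := by
  have h1 : 0 < τ := by rw [hτ]; positivity
  have h2 : τ * (a * b) = δ + δ ^ 2 / 2 := by rw [hτ]; field_simp
  have h3 : 0 < δ ^ 2 := by positivity
  have h4 : a * τ * b ≤ a * τ * 1 := mul_le_mul_of_nonneg_left (by linarith) (by positivity)
  have h5 : b * τ * a ≤ b * τ * 1 := mul_le_mul_of_nonneg_left (by linarith) (by positivity)
  have h6 : a * τ ≤ 1 * τ := mul_le_mul_of_nonneg_right (by linarith) h1.le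
  refine ⟨?_, ?_, ?_⟩ <;> nlinarith

/-- For δ ≤ 1 one has δ ≤ τ ≤ 2δ/(ab); the loss log(1/(ab)) is absorbed into 1/(ab). -/
lemma abs_log_gap_sub_le {τ δ a b : ℝ} (ha : 0 < a) (hb : 0 < b) (hab : a + b = 1) (hδ : 0 < δ)
    (hδ1 : δ ≤ 1) (hτ : τ = (δ + δ ^ 2 / 2) / (a * b)) :
    |Real.log (1 + 1 / τ) - (|Real.log δ|)| ≤ 1 / (a * b) := by
  have hτ0 : 0 < τ := by rw [hτ]; positivity
  have hlogδ : |Real.log δ| = -Real.log δ := abs_of_nonpos (Real.log_nonpos hδ.le hδ1)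
  have hab1 : 1 ≤ 1 / (a * b) := by
    rw [le_div_iff₀ (by positivity)]; nlinarith
  have hlog2 : Real.log 2 ≤ 1 := by
    have := Real.log_le_sub_one_of_pos (by norm_num : (0 : ℝ) < 2)
    linarith
  have hup : Real.log (1 + 1 / τ) ≤ Real.log (2 / δ) := by
    apply Real.log_le_log (by positivity)
    have h1 : 1 / τ ≤ 1 / δ := one_div_le_one_div_of_le hδ (le_gap ha hb hab hδ hτ).1
    have h2 : 1 ≤ 1 / δ := by rw [le_div_iff₀ hδ]; linarith
    have h3 : 2 / δ = 1 / δ + 1 / δ := by ring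
    linarith
  have hlo : Real.log (a * b / (2 * δ)) ≤ Real.log (1 + 1 / τ) := by
    apply Real.log_le_log (by positivity)
    have h1 : a * b / (2 * δ) ≤ 1 / τ := by
      rw [hτ, one_div_div]
      apply div_le_div_of_nonneg_left (by positivity) (by positivity)
      nlinarith
    linarith
  have hlab : -Real.log (a * b) ≤ 1 / (a * b) - 1 := by
    rw [← Real.log_inv, ← one_div]
    exact Real.log_le_sub_one_of_pos (by positivity)
  rw [Real.log_div (by norm_num) hδ.ne'] at hup
  rw [Real.log_div (by positivity) (by positivity), Real.log_mul (by norm_num) hδ.ne'] at hlo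
  rw [hlogδ, abs_le]
  constructor <;> linarith

/-- The error splits into five parts: the product Q₁Q₂, the factor 1/(1+δ), the error in S, the
error in Q_i, and the change of logarithm. They contribute at most 1, 4, 3, 10 and 1/(2ab), and
1/(ab) ≥ 1 absorbs the constants. -/
lemma abs_energy_sub_le {τ δ a b : ℝ} (ha : 0 < a) (hb : 0 < b) (hab : a + b = 1) (hδ : 0 < δ)
    (hδ1 : δ ≤ 1) (hτ : τ = (δ + δ ^ 2 / 2) / (a * b)) :
    |altSum τ δ a * altSum τ δ b + (∑' k, 1 / chebSeq τ (k + 1)) / (1 + δ) *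
        (a * altSum τ δ b + b * altSum τ δ a) -
      |Real.log δ| / 2 * (a * altSum 0 0 b + b * altSum 0 0 a)| ≤ 19 / (a * b) := by
  have hτ0 : 0 < τ := by rw [hτ]; positivity
  have ha1 : a < 1 := by linarith
  have hb1 : b < 1 := by linarith
  obtain ⟨hδτ, hδa, hδb⟩ := le_gap ha hb hab hδ hτ
  have hδa' : δ ≤ 2 * a * τ := by linarith
  have hδb' : δ ≤ 2 * b * τ := by linarith
  have hab1 : 1 ≤ 1 / (a * b) := by
    rw [le_div_iff₀ (by positivity)]; nlinarith
  have hlog0 : 0 < 1 / τ := by positivity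
  have hS := abs_tsum_one_div_chebSeq_sub_le hτ0
  have hA := abs_altSum_sub_mul_log_le hτ0 hδ.le hδτ hδa' ha ha1
  have hB := abs_altSum_sub_mul_log_le hτ0 hδ.le hδτ hδb' hb hb1
  have hl := abs_log_gap_sub_le ha hb hab hδ hδ1 hτ
  have hℓ0 : 0 ≤ Real.log (1 + 1 / τ) := Real.log_nonneg (by linarith)
  have hℓ1 : Real.log (1 + 1 / τ) ≤ 1 / τ := by
    have := Real.log_le_sub_one_of_pos (by positivity : 0 < 1 + 1 / τ)
    linarith
  have hA0 := altSum_nonneg hτ0.le hδ.le ha ha1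
  have hA1 := altSum_le_one hτ0.le hδ.le hδa' ha ha1
  have hB0 := altSum_nonneg hτ0.le hδ.le hb hb1
  have hB1 := altSum_le_one hτ0.le hδ.le hδb' hb hb1
  have hA0' := altSum_nonneg (τ := 0) (δ := 0) le_rfl le_rfl ha ha1
  have hA1' := altSum_le_one (τ := 0) (δ := 0) le_rfl le_rfl (by simp) ha ha1
  have hB0' := altSum_nonneg (τ := 0) (δ := 0) le_rfl le_rfl hb hb1
  have hB1' := altSum_le_one (τ := 0) (δ := 0) le_rfl le_rfl (by simp) hb hb1
  have hS0 : 0 ≤ ∑' k, 1 / chebSeq τ (k + 1) :=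
    tsum_nonneg fun k => one_div_nonneg.mpr (chebSeq_nonneg hτ0.le _)
  set S := ∑' k, 1 / chebSeq τ (k + 1)
  set ℓ := Real.log (1 + 1 / τ)
  set A := altSum τ δ a
  set B := altSum τ δ b
  set A' := altSum 0 0 a
  set B' := altSum 0 0 b
  -- Although S diverges, δ ≤ τ and log(1+1/τ) ≤ 1/τ keep δS bounded.
  have hδS : δ * S ≤ 4 := by
    have h1 : δ * ℓ ≤ 1 := by
      calc δ * ℓ ≤ τ * (1 / τ) := mul_le_mul hδτ hℓ1 hℓ0 hτ0.le
        _ = 1 := by field_simp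
    have h2 : δ * S ≤ δ * (ℓ / 2 + 3) :=
      mul_le_mul_of_nonneg_left (by linarith [(abs_le.mp hS).2]) hδ.le
    nlinarith
  have hK : |a * B + b * A| ≤ 1 := by
    rw [abs_of_nonneg (by positivity)]; nlinarith
  have hK' : |a * B' + b * A'| ≤ 1 := by
    rw [abs_of_nonneg (by positivity)]; nlinarith
  have t0 : |A * B| ≤ 1 := by
    rw [abs_of_nonneg (by positivity)]; nlinarith
  have t1 : |δ * S / (1 + δ) * (a * B + b * A)| ≤ 4 := by
    rw [abs_mul, abs_of_nonneg (by positivity : 0 ≤ δ * S / (1 + δ))]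
    have h1 : δ * S / (1 + δ) ≤ 4 := by
      rw [div_le_iff₀ (by positivity)]; nlinarith
    calc _ ≤ (4 : ℝ) * 1 := mul_le_mul h1 hK (abs_nonneg _) (by norm_num)
      _ = 4 := by norm_num
  have t2 : |(S - ℓ / 2) * (a * B + b * A)| ≤ 3 := by
    rw [abs_mul]
    calc _ ≤ (3 : ℝ) * 1 := mul_le_mul hS hK (abs_nonneg _) (by norm_num)
      _ = 3 := by norm_num
  have t3 : |ℓ / 2 * (a * B + b * A - (a * B' + b * A'))| ≤ 10 := by
    rw [abs_mul, abs_of_nonneg (by positivity : 0 ≤ ℓ / 2)]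
    have h1 : |a * B + b * A - (a * B' + b * A')| ≤ a * |B - B'| + b * |A - A'| := by
      rw [show a * B + b * A - (a * B' + b * A') = a * (B - B') + b * (A - A') by ring]
      refine (abs_add_le _ _).trans (le_of_eq ?_)
      rw [abs_mul, abs_mul, abs_of_pos ha, abs_of_pos hb]
    calc _ ≤ ℓ / 2 * (a * |B - B'| + b * |A - A'|) :=
          mul_le_mul_of_nonneg_left h1 (by positivity)
      _ = (a * (|B - B'| * ℓ) + b * (|A - A'| * ℓ)) / 2 := by ring
      _ ≤ (a * 20 + b * 20) / 2 := by gcongr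
      _ = 10 := by linarith
  have t4 : |(ℓ - |Real.log δ|) / 2 * (a * B' + b * A')| ≤ 1 / (a * b) / 2 := by
    rw [abs_mul, abs_div, abs_two]
    calc _ ≤ 1 / (a * b) / 2 * 1 := by gcongr
      _ = _ := by ring
  have e : A * B + S / (1 + δ) * (a * B + b * A) - |Real.log δ| / 2 * (a * B' + b * A') =
      A * B - δ * S / (1 + δ) * (a * B + b * A) + (S - ℓ / 2) * (a * B + b * A) +
        ℓ / 2 * (a * B + b * A - (a * B' + b * A')) +
        (ℓ - |Real.log δ|) / 2 * (a * B' + b * A') := by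
    field_simp; ring
  have h19 : 19 / (a * b) = 19 * (1 / (a * b)) := by ring
  rw [e, h19, abs_le]
  rw [abs_le] at t0 t1 t2 t3 t4
  constructor <;> linarith [t0.1, t0.2, t1.1, t1.2, t2.1, t2.2, t3.1, t3.2, t4.1, t4.2]

/-! ### Return to the two balls. -/

section Configuration

variable {r1 r2 ε : ℝ}

lemma ratio_mem (h1 : 0 < r1) (h2 : 0 < r2) : 0 < r1 / (r1 + r2) ∧ 0 < r2 / (r1 + r2) ∧
    r1 / (r1 + r2) + r2 / (r1 + r2) = 1 :=
  ⟨by positivity, by positivity, by field_simp⟩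

lemma q1_sums (h1 : 0 < r1) (h2 : 0 < r2) (hε : 0 < ε) :
    Summable (q1 r1 r2 ε) ∧
      Q1 r1 r2 ε = altSum (gapParam r1 r2 ε) (2 * ε / (r1 + r2)) (r2 / (r1 + r2)) ∧
      ∑' k, q1 r1 r2 ε (2 * k) = Q1 r1 r2 ε + r2 / (r1 + r2) / (1 + 2 * ε / (r1 + r2)) *
        ∑' k, 1 / chebSeq (gapParam r1 r2 ε) (k + 1) ∧
      ∑' k, q1 r1 r2 ε (2 * k + 1) = r2 / (r1 + r2) / (1 + 2 * ε / (r1 + r2)) *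
        ∑' k, 1 / chebSeq (gapParam r1 r2 ε) (k + 1) := by
  obtain ⟨ha, hb, hab⟩ := ratio_mem h1 h2
  obtain ⟨e1, e2, e3, e4⟩ := sums_of_weights (gapParam_pos h1 h2 hε)
    (by positivity : 0 ≤ 2 * ε / (r1 + r2)) hb (by linarith) (q1_eq h1 h2 hε)
  exact ⟨e1, e2, by rw [Q1, e2, e3], e4⟩

lemma q2_sums (h1 : 0 < r1) (h2 : 0 < r2) (hε : 0 < ε) :
    Summable (q2 r1 r2 ε) ∧
      Q2 r1 r2 ε = altSum (gapParam r1 r2 ε) (2 * ε / (r1 + r2)) (r1 / (r1 + r2)) ∧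
      ∑' k, q2 r1 r2 ε (2 * k) = Q2 r1 r2 ε + r1 / (r1 + r2) / (1 + 2 * ε / (r1 + r2)) *
        ∑' k, 1 / chebSeq (gapParam r1 r2 ε) (k + 1) ∧
      ∑' k, q2 r1 r2 ε (2 * k + 1) = r1 / (r1 + r2) / (1 + 2 * ε / (r1 + r2)) *
        ∑' k, 1 / chebSeq (gapParam r1 r2 ε) (k + 1) := by
  obtain ⟨ha, hb, hab⟩ := ratio_mem h1 h2
  obtain ⟨e1, e2, e3, e4⟩ := sums_of_weights (gapParam_pos h1 h2 hε)
    (by positivity : 0 ≤ 2 * ε / (r1 + r2)) ha (by linarith) (q2_eq h1 h2 hε)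
  exact ⟨e1, e2, by rw [Q2, e2, e3], e4⟩

end Configuration

/-- The limit of the alternating sum as the spheres approach contact. -/
lemma tendsto_altSum {a b s : ℝ} (ha : 0 < a) (hb : 0 < b) (hab : a + b = 1) (hs : 0 < s)
    {τ : ℝ → ℝ} (hτ : ∀ ε, τ ε = (2 * ε / s + (2 * ε / s) ^ 2 / 2) / (a * b)) :
    Tendsto (fun ε => altSum (τ ε) (2 * ε / s) b) (𝓝[>] 0) (𝓝 (-b * psi b)) := by
  have hb1 : b < 1 := by linarith
  rw [← altSum_zero hb hb1, tendsto_iff_norm_sub_tendsto_zero]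
  have hτ0 : Tendsto τ (𝓝[>] 0) (𝓝[>] 0) := by
    refine tendsto_nhdsWithin_iff.mpr ⟨?_, ?_⟩
    · have hc : Continuous τ := by
        rw [show τ = _ from funext hτ]; fun_prop
      have h0 : τ 0 = 0 := by simp [hτ]
      have := hc.tendsto 0
      rw [h0] at this
      exact this.mono_left nhdsWithin_le_nhds
    · filter_upwards [self_mem_nhdsWithin] with ε hε
      have hε : 0 < ε := hε
      rw [Set.mem_Ioi, hτ]; positivity
  have hlog : Tendsto (fun ε => Real.log (1 + 1 / τ ε)) (𝓝[>] 0) atTop := by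
    refine Real.tendsto_log_atTop.comp (tendsto_atTop_add_const_left _ _ ?_)
    simp only [one_div]
    exact tendsto_inv_nhdsGT_zero.comp hτ0
  have hlim : Tendsto (fun ε => 20 / Real.log (1 + 1 / τ ε)) (𝓝[>] 0) (𝓝 0) :=
    hlog.const_div_atTop 20
  refine tendsto_of_tendsto_of_tendsto_of_le_of_le' tendsto_const_nhds hlim
    (Eventually.of_forall fun _ => norm_nonneg _) ?_
  filter_upwards [self_mem_nhdsWithin, hlog.eventually_gt_atTop 0] with ε hε hpos
  have hε : 0 < ε := hε
  have hδ : 0 < 2 * ε / s := by positivity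
  obtain ⟨hδτ, -, hδb⟩ := le_gap ha hb hab hδ (hτ ε)
  have hτε : 0 < τ ε := by linarith
  rw [Real.norm_eq_abs, le_div_iff₀ hpos]
  exact abs_altSum_sub_mul_log_le hτε hδ.le hδτ (by linarith) hb hb1

/-- The leading term of `M` with an error that is uniform in the radii. -/
lemma abs_M_sub_le {r1 r2 R ε : ℝ} (h1 : 0 < r1) (h2 : 0 < r2) (hR : max r1 r2 = R) (hε : 0 < ε)
    (hεR : ε ≤ R / 2) :
    |M r1 r2 ε - |Real.log ε| / 2 * (r1 / (r1 + r2) * altSum 0 0 (r2 / (r1 + r2)) +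
        r2 / (r1 + r2) * altSum 0 0 (r1 / (r1 + r2)))| ≤
      (19 + |Real.log (1 / R)| + |Real.log (2 / R)|) /
        (r1 / (r1 + r2) * (r2 / (r1 + r2))) := by
  obtain ⟨ha, hb, hab⟩ := ratio_mem h1 h2
  have hRle : R ≤ r1 + r2 := by rw [← hR]; exact max_le (by linarith) (by linarith)
  have hle2 : r1 + r2 ≤ 2 * R := by
    rw [← hR]; linarith [le_max_left r1 r2, le_max_right r1 r2]
  have hR0 : 0 < R := by rw [← hR]; exact h1.trans_le (le_max_left _ _)
  have hδ : 0 < 2 * ε / (r1 + r2) := by positivity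
  have hδ1 : 2 * ε / (r1 + r2) ≤ 1 := by rw [div_le_one (by positivity)]; linarith
  have hmain := abs_energy_sub_le ha hb hab hδ hδ1 (gapParam_eq h1 h2 ε)
  obtain ⟨-, hQ1, hE1, hO1⟩ := q1_sums h1 h2 hε
  obtain ⟨-, hQ2, hE2, hO2⟩ := q2_sums h1 h2 hε
  have hlogδ : Real.log (2 * ε / (r1 + r2)) = Real.log ε + Real.log (2 / (r1 + r2)) := by
    rw [← Real.log_mul hε.ne' (by positivity)]; congr 1; ring
  -- Since R ≤ r₁+r₂ ≤ 2R, passing from δ to ε costs a constant depending only on R.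
  have hshift : |Real.log (2 / (r1 + r2))| ≤ |Real.log (1 / R)| + |Real.log (2 / R)| := by
    have l1 : Real.log (1 / R) ≤ Real.log (2 / (r1 + r2)) := by
      apply Real.log_le_log (by positivity)
      rw [div_le_div_iff₀ hR0 (by positivity)]; linarith
    have l2 : Real.log (2 / (r1 + r2)) ≤ Real.log (2 / R) := by
      apply Real.log_le_log (by positivity)
      exact div_le_div_of_nonneg_left (by norm_num) hR0 hRle
    have := neg_abs_le (Real.log (1 / R))
    have := le_abs_self (Real.log (2 / R))
    have := abs_nonneg (Real.log (1 / R))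
    have := abs_nonneg (Real.log (2 / R))
    rw [abs_le]; constructor <;> linarith
  have hdiff : |(|Real.log (2 * ε / (r1 + r2))|) - (|Real.log ε|)| ≤
      |Real.log (1 / R)| + |Real.log (2 / R)| := by
    refine (abs_abs_sub_abs_le _ _).trans ?_
    rwa [hlogδ, add_sub_cancel_left]
  have eM : M r1 r2 ε = Q2 r1 r2 ε * Q1 r1 r2 ε +
      (∑' k, 1 / chebSeq (gapParam r1 r2 ε) (k + 1)) / (1 + 2 * ε / (r1 + r2)) *
        (r1 / (r1 + r2) * Q1 r1 r2 ε + r2 / (r1 + r2) * Q2 r1 r2 ε) := by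
    rw [M, hE1, hO2]; ring
  rw [← hQ1, ← hQ2, ← eM] at hmain
  have hA0' := altSum_nonneg (τ := 0) (δ := 0) le_rfl le_rfl ha (by linarith)
  have hA1' := altSum_le_one (τ := 0) (δ := 0) le_rfl le_rfl (by simp) ha (by linarith)
  have hB0' := altSum_nonneg (τ := 0) (δ := 0) le_rfl le_rfl hb (by linarith)
  have hB1' := altSum_le_one (τ := 0) (δ := 0) le_rfl le_rfl (by simp) hb (by linarith)
  set a := r1 / (r1 + r2)
  set b := r2 / (r1 + r2)
  set K := a * altSum 0 0 b + b * altSum 0 0 a with hK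
  have hK0 : 0 ≤ K := by positivity
  have hK1 : K ≤ 1 := by nlinarith
  set B := |Real.log (1 / R)| + |Real.log (2 / R)| with hBdef
  have hB : 0 ≤ B := by positivity
  have hBab : B ≤ B / (a * b) := by
    rw [le_div_iff₀ (by positivity)]
    have : a * b ≤ 1 := by nlinarith
    nlinarith
  have t : |(|Real.log (2 * ε / (r1 + r2))| - |Real.log ε|) / 2 * K| ≤ B := by
    rw [abs_mul, abs_div, abs_two, abs_of_nonneg hK0]
    calc _ ≤ B / 2 * 1 := by gcongr
      _ ≤ B := by linarith
  have e19 : (19 + |Real.log (1 / R)| + |Real.log (2 / R)|) / (a * b) =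
      19 / (a * b) + B / (a * b) := by rw [hBdef]; ring
  rw [e19]
  rw [abs_le] at hmain t ⊢
  constructor <;> linarith [hmain.1, hmain.2, t.1, t.2]

/-- The first pair alone gives the contact values at least 1-b = a and 1-a = b, and a² + b² ≥ 1/2.
This permits a relative error estimate uniform in the radii. -/
lemma half_le_weighted_altSum {a b : ℝ} (ha : 0 < a) (hb : 0 < b) (hab : a + b = 1) :
    1 / 2 ≤ a * altSum 0 0 b + b * altSum 0 0 a := by
  have h1 := one_sub_le_altSum_zero hb (by linarith)
  have h2 := one_sub_le_altSum_zero ha (by linarith)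
  have h3 := mul_le_mul_of_nonneg_left h1 ha.le
  have h4 := mul_le_mul_of_nonneg_left h2 hb.le
  nlinarith [sq_nonneg (a - b)]

end

end TwoSpheres

open TwoSpheres in
theorem proposition2p2 :
    -- the series converge, and the two expressions for `M` agree
    (∀ r1 r2 ε : ℝ, 0 < r1 → 0 < r2 → 0 < ε →
      Summable (q1 r1 r2 ε) ∧ Summable (q2 r1 r2 ε) ∧
      M r1 r2 ε = Q1 r1 r2 ε * (∑' k : ℕ, q2 r1 r2 ε (2 * k)) +
        Q2 r1 r2 ε * (∑' k : ℕ, q1 r1 r2 ε (2 * k + 1))) ∧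
    -- the closed forms of `Q₁` and `Q₂` in the limit `ε → 0⁺`
    (∀ r1 r2 : ℝ, 0 < r1 → 0 < r2 →
      Tendsto (fun ε : ℝ => Q1 r1 r2 ε) (𝓝[>] 0)
        (𝓝 (-(r2 / (r1 + r2)) * psi (r2 / (r1 + r2)))) ∧
      Tendsto (fun ε : ℝ => Q2 r1 r2 ε) (𝓝[>] 0)
        (𝓝 (-(r1 / (r1 + r2)) * psi (r1 / (r1 + r2))))) ∧
    -- the asymptotics of `M`, uniformly in the ratio of the radii
    (∀ R : ℝ, 0 < R → ∃ C ε₀ : ℝ, 0 < C ∧ 0 < ε₀ ∧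
      ∀ r1 r2 : ℝ, 0 < r1 → 0 < r2 → max r1 r2 = R →
        ∀ ε : ℝ, 0 < ε → ε < ε₀ →
          ∃ θ : ℝ, |θ| ≤ C * |Real.log ε|⁻¹ ∧
            M r1 r2 ε = -(1 / 2) * (r1 * r2 / (r1 + r2) ^ 2) * |Real.log ε| *
              (psi (r1 / (r1 + r2)) + psi (r2 / (r1 + r2))) *
              (1 + (r1 + r2) / min r1 r2 * θ)) := by
  refine ⟨fun r1 r2 ε h1 h2 hε => ?_, fun r1 r2 h1 h2 => ?_, fun R hR => ?_⟩
  · obtain ⟨s1, -, hE1, hO1⟩ := q1_sums h1 h2 hε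
    obtain ⟨s2, -, hE2, hO2⟩ := q2_sums h1 h2 hε
    refine ⟨s1, s2, ?_⟩
    rw [M, hE1, hO1, hE2, hO2]
    ring
  · obtain ⟨ha, hb, hab⟩ := ratio_mem h1 h2
    constructor
    · refine (tendsto_altSum ha hb hab (by positivity : 0 < r1 + r2)
        (gapParam_eq h1 h2)).congr' ?_
      filter_upwards [self_mem_nhdsWithin] with ε hε
      exact (q1_sums h1 h2 hε).2.1.symm
    · refine (tendsto_altSum hb ha (by linarith) (by positivity : 0 < r1 + r2)
        (fun ε => (gapParam_eq h1 h2 ε).trans (by rw [mul_comm (r1 / _)]))).congr' ?_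
      filter_upwards [self_mem_nhdsWithin] with ε hε
      exact (q2_sums h1 h2 hε).2.1.symm
  · set B := 19 + |Real.log (1 / R)| + |Real.log (2 / R)| with hB
    have hB0 : 0 < B := by positivity
    refine ⟨8 * B, min (1 / 2) (R / 2), by positivity, by positivity, ?_⟩
    intro r1 r2 h1 h2 hmax ε hε hε0
    obtain ⟨ha, hb, hab⟩ := ratio_mem h1 h2
    have hεR : ε ≤ R / 2 := (hε0.trans_le (min_le_right _ _)).le
    have hε1 : ε < 1 := (hε0.trans_le (min_le_left _ _)).trans (by norm_num)
    have hL : 0 < |Real.log ε| := abs_pos.mpr (Real.log_neg hε hε1).ne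
    have hmain := abs_M_sub_le h1 h2 hmax hε hεR
    have hK := half_le_weighted_altSum ha hb hab
    have hKψ : r1 / (r1 + r2) * altSum 0 0 (r2 / (r1 + r2)) +
        r2 / (r1 + r2) * altSum 0 0 (r1 / (r1 + r2)) =
        -(r1 * r2 / (r1 + r2) ^ 2) * (psi (r1 / (r1 + r2)) + psi (r2 / (r1 + r2))) := by
      rw [altSum_zero ha (by linarith), altSum_zero hb (by linarith),
        show r1 * r2 / (r1 + r2) ^ 2 = r1 / (r1 + r2) * (r2 / (r1 + r2)) by field_simp]
      ring
    rw [← hB] at hmain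
    have hm : 0 < min r1 r2 := lt_min h1 h2
    -- This converts the loss 1/(ab) into the factor (r₁+r₂)/min(r₁,r₂) of the claim.
    have hmab : min r1 r2 / (r1 + r2) ≤ 2 * (r1 / (r1 + r2) * (r2 / (r1 + r2))) := by
      have hmm : min r1 r2 * max r1 r2 = r1 * r2 := min_mul_max r1 r2
      have hs : r1 + r2 ≤ 2 * max r1 r2 := by linarith [le_max_left r1 r2, le_max_right r1 r2]
      rw [div_mul_div_comm, ← hmm, mul_div_assoc', div_le_div_iff₀ (by positivity) (by positivity)]
      have := mul_le_mul_of_nonneg_left hs (by positivity : 0 ≤ min r1 r2 * (r1 + r2))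
      nlinarith
    generalize r1 / (r1 + r2) * altSum 0 0 (r2 / (r1 + r2)) +
        r2 / (r1 + r2) * altSum 0 0 (r1 / (r1 + r2)) = K at hmain hK hKψ
    have hM0 : 0 < |Real.log ε| / 2 * K := by positivity
    have hlead : -(1 / 2) * (r1 * r2 / (r1 + r2) ^ 2) * |Real.log ε| *
        (psi (r1 / (r1 + r2)) + psi (r2 / (r1 + r2))) = |Real.log ε| / 2 * K := by
      rw [hKψ]; ring
    rw [hlead]
    have hM0' : |Real.log ε| / 4 ≤ |Real.log ε| / 2 * K := by nlinarith
    -- θ is the relative error rescaled by min(r₁,r₂)/(r₁+r₂). Absolute error B/(ab), main term at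
    -- least |log ε|/4 and rescaling at most 2ab together give the constant 8B.
    refine ⟨min r1 r2 / (r1 + r2) *
      ((M r1 r2 ε - |Real.log ε| / 2 * K) / (|Real.log ε| / 2 * K)), ?_, ?_⟩
    · rw [abs_mul, abs_of_pos (by positivity : 0 < min r1 r2 / (r1 + r2)), abs_div,
        abs_of_pos hM0]
      set P := r1 / (r1 + r2) * (r2 / (r1 + r2))
      have hP : 0 < P := mul_pos ha hb
      calc _ ≤ 2 * P * (B / P / (|Real.log ε| / 4)) := by gcongr
        _ = 8 * B * |Real.log ε|⁻¹ := by field_simp; norm_num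
    · generalize |Real.log ε| / 2 * K = M0 at hM0
      field_simp
      ring
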